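/- Let $Y$ be a real Banach space. The following are equivalent: (i) for every Banach lattice $X$, every continuous linear operator $T:X\to Y$ is quasi $KB$, i.e. for every norm-bounded increasing net $(x_\alpha)$ in $X_+=\{x\in X: x\ge 0\}$ the net $(Tx_\alpha)$ is norm-Cauchy in $Y$; (ii) $c_0$ does not embed in $Y$, i.e. there is no continuous linear operator $J:c_0\to Y$ that is an isomorphism onto its image (equivalently, no bounded linear $J:c_0\to Y$ with $\|Jx\|\ge c\|x\|$ for all $x\in c_0$ and some constant $c>0$), where $c_0$ is the space of real null sequences with the supremum norm. -/

import Mathlib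

open scoped ZeroAtInfty

universe u v w

/-- A linear operator `T` from a normed lattice `X` to a normed space `Y` is *quasi KB* if it maps
every norm-bounded increasing net in the positive cone `X₊` to a norm-Cauchy net. The nets are
indexed by nonempty directed preordered sets in the universe `w`. -/
def IsQuasiKB {X : Type u} {Y : Type v} [NormedAddCommGroup X] [NormedSpace ℝ X] [Lattice X]
    [NormedAddCommGroup Y] [NormedSpace ℝ Y] (T : X →ₗ[ℝ] Y) : Prop :=
  ∀ (ι : Type w) [Preorder ι] [IsDirectedOrder ι] [Nonempty ι] (x : ι → X),
    Monotone x → (∀ a, 0 ≤ x a) → (∃ M : ℝ, ∀ a, ‖x a‖ ≤ M) →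
      Cauchy (Filter.map (fun a => T (x a)) Filter.atTop)

/-- The Banach space `c₀` of real null sequences with the supremum norm (`C₀(ℕ, ℝ)`, with `ℕ`
discrete) embeds in `Y`: there is a bounded linear operator `J : c₀ → Y` that is bounded below,
that is, an isomorphism onto its image. -/
def CZeroEmbeds (Y : Type v) [NormedAddCommGroup Y] [NormedSpace ℝ Y] : Prop :=
  ∃ J : C₀(ℕ, ℝ) →L[ℝ] Y, ∃ c : ℝ, 0 < c ∧ ∀ x : C₀(ℕ, ℝ), c * ‖x‖ ≤ ‖J x‖

/-!
If `J : c₀ → Y` is an embedding, then `J` itself fails to be quasi KB: the indicators of the initial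
segments of `ℕ` increase in the unit ball of the Banach lattice `c₀`, consecutive ones are at
distance `1`, and `J` is bounded below. (To reach an arbitrary universe, `c₀` is realised over
`ULift ℕ`.)

Conversely, let `T : X → Y` map some bounded increasing net to a net that is not Cauchy. Then there
is an increasing sequence `x₀ ≤ x₁ ≤ …` in the net with `‖T (xₙ₊₁ - xₙ)‖ ≥ ε`. The increments
`uₙ = xₙ₊₁ - xₙ` are positive with bounded finite sums, so solidity of the norm gives
`‖∑ cᵢ uᵢ‖ ≤ K sup |cᵢ|` for all finite sums (`norm_sum_smul_le_of_nonneg`), and `yₙ = T uₙ` inherits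
this estimate: `∑ yₙ` is weakly unconditionally Cauchy and `yₙ` does not tend to `0`. By a theorem of
Bessaga and Pełczyński this forces `c₀` into `Y` (`cZeroEmbeds_of_norm_sum_smul_le`). No basic
sequences are needed for it: choose norming functionals `fₙ` of `yₙ`. The matrix `|fₙ(yᵢ)|` has
bounded row sums, so by Rosenthal's disjointification lemma (`exists_injective_offDiag_sum_le`) one
may pass to a subfamily for which the off-diagonal row sums are at most `ε / 2`. Testing `∑ xᵢ yᵢ`
against `fₙ` then gives `‖∑ xᵢ yᵢ‖ ≥ ε |xₙ| - (ε / 2) ‖x‖` for every `n`, which is a lower bound by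
`(ε / 2) ‖x‖`.
-/

/-! ### Rosenthal's disjointification lemma -/

/-- A form of Rosenthal's lemma: if every finite row sum of a matrix is at most `k * δ`, then some
infinite square submatrix has all its finite off-diagonal row sums at most `δ`.

The proof is by induction on `k`. Split `ℕ` into infinitely many infinite classes. If no class
works, then the class `p` contains an index `n p` whose row sum over the rest of that class exceeds
`δ`; over the set of all these `n p`, which meets each class only once, the row sums of the rows
`n p` have therefore dropped by `δ`. -/
theorem exists_injective_offDiag_sum_le {δ : ℝ} (hδ : 0 ≤ δ) (k : ℕ) (a : ℕ → ℕ → ℝ)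
    (ha : ∀ n (s : Finset ℕ), ∑ i ∈ s, a n i ≤ k * δ) :
    ∃ σ : ℕ → ℕ, Function.Injective σ ∧
      ∀ n (s : Finset ℕ), n ∉ s → ∑ i ∈ s, a (σ n) (σ i) ≤ δ := by
  induction k generalizing a with
  | zero => exact ⟨id, Function.injective_id, fun n s _ => (ha n s).trans (by simpa using hδ)⟩
  | succ k ih =>
    by_cases h : ∃ p : ℕ, ∀ n (s : Finset ℕ), n ∉ s →
        ∑ i ∈ s, a (Nat.pair p n) (Nat.pair p i) ≤ δ
    · obtain ⟨p, hp⟩ := h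
      exact ⟨Nat.pair p, fun m n hmn => (Nat.pair_eq_pair.1 hmn).2, hp⟩
    · push Not at h
      choose n s hns hs using h
      obtain ⟨σ, hσ, hσ'⟩ := ih (fun p q => a (Nat.pair p (n p)) (Nat.pair q (n q))) (by
        intro p t
        have h1 : Function.Injective (Nat.pair p) := fun m n hmn => (Nat.pair_eq_pair.1 hmn).2
        have h2 : Function.Injective (fun q => Nat.pair q (n q)) :=
          fun m n hmn => (Nat.pair_eq_pair.1 hmn).1
        have hd : Disjoint (t.image fun q => Nat.pair q (n q)) ((s p).image (Nat.pair p)) := by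
          simp only [Finset.disjoint_left, Finset.mem_image, not_exists, not_and]
          rintro _ ⟨q, -, rfl⟩ i hi hiq
          obtain ⟨rfl, rfl⟩ := Nat.pair_eq_pair.1 hiq
          exact hns _ hi
        have h3 := ha (Nat.pair p (n p)) ((t.image fun q => Nat.pair q (n q)) ∪
          (s p).image (Nat.pair p))
        rw [Finset.sum_union hd, Finset.sum_image h2.injOn, Finset.sum_image h1.injOn] at h3
        have h4 := hs p
        push_cast at h3
        linarith)
      exact ⟨fun p => Nat.pair (σ p) (n (σ p)),
        fun p q hpq => hσ (Nat.pair_eq_pair.1 hpq).1, hσ'⟩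

/-! ### The Bessaga–Pełczyński theorem -/

namespace ZeroAtInftyContinuousMap

theorem norm_apply_le {ι : Type*} [TopologicalSpace ι] (x : C₀(ι, ℝ)) (i : ι) : |x i| ≤ ‖x‖ :=
  x.toBCF.norm_coe_le_norm i

theorem norm_le_of_forall {ι : Type*} [TopologicalSpace ι] {x : C₀(ι, ℝ)} {C : ℝ} (hC : 0 ≤ C)
    (h : ∀ i, |x i| ≤ C) : ‖x‖ ≤ C :=
  (BoundedContinuousFunction.norm_le hC).2 h

end ZeroAtInftyContinuousMap

section BessagaPelczynski

variable {Y : Type*} [NormedAddCommGroup Y] [NormedSpace ℝ Y]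

/-- A weakly unconditionally Cauchy series becomes unconditionally summable after termwise
multiplication by a null sequence. -/
theorem summable_smul_of_norm_sum_smul_le [CompleteSpace Y] {y : ℕ → Y} {K : ℝ}
    (hy : ∀ (s : Finset ℕ) (c : ℕ → ℝ) (M : ℝ), 0 ≤ M → (∀ i ∈ s, |c i| ≤ M) →
      ‖∑ i ∈ s, c i • y i‖ ≤ M * K) (x : C₀(ℕ, ℝ)) : Summable fun i => x i • y i := by
  have hK : 0 ≤ K := by simpa using hy ∅ 0 1 zero_le_one (by simp)
  rw [summable_iff_vanishing_norm]
  intro ε hε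
  have hx : Filter.Tendsto x Filter.cofinite (nhds 0) := by
    rw [← Filter.cocompact_eq_cofinite]
    exact x.zero_at_infty'
  have hη : 0 < ε / (K + 1) := by positivity
  have hfin : {i | ¬ |x i| < ε / (K + 1)}.Finite := by
    have := hx.eventually (Metric.ball_mem_nhds 0 hη)
    simpa [Filter.eventually_cofinite] using this
  refine ⟨hfin.toFinset, fun t ht => ?_⟩
  refine (hy t x _ hη.le fun i hi => ?_).trans_lt ?_
  · by_contra hlt
    exact Finset.disjoint_left.1 ht hi (hfin.mem_toFinset.2 fun h => hlt h.le)
  · rw [div_mul_eq_mul_div, div_lt_iff₀ (by positivity)]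
    linarith

/-- A series with `‖∑ cᵢ yᵢ‖ ≤ K sup |cᵢ|` for all finite sums, whose terms are bounded away from
zero, produces an embedding of `c₀`. -/
theorem cZeroEmbeds_of_norm_sum_smul_le [CompleteSpace Y] {y : ℕ → Y} {K ε : ℝ}
    (hy : ∀ (s : Finset ℕ) (c : ℕ → ℝ) (M : ℝ), 0 ≤ M → (∀ i ∈ s, |c i| ≤ M) →
      ‖∑ i ∈ s, c i • y i‖ ≤ M * K)
    (hε : 0 < ε) (hyε : ∀ n, ε ≤ ‖y n‖) : CZeroEmbeds Y := by
  choose f hf hfy using fun n => exists_dual_vector'' ℝ (y n)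
  have hrow : ∀ n (s : Finset ℕ), ∑ i ∈ s, |f n (y i)| ≤ K := by
    intro n s
    calc ∑ i ∈ s, |f n (y i)|
        = f n (∑ i ∈ s, (SignType.sign (f n (y i)) : ℝ) • y i) := by
          simp only [map_sum, map_smul, smul_eq_mul, sign_mul_self]
      _ ≤ ‖f n (∑ i ∈ s, (SignType.sign (f n (y i)) : ℝ) • y i)‖ := le_abs_self _
      _ ≤ ‖∑ i ∈ s, (SignType.sign (f n (y i)) : ℝ) • y i‖ :=
          ((f n).le_of_opNorm_le (hf n) _).trans (one_mul _).le
      _ ≤ 1 * K := by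
          refine hy s _ 1 zero_le_one fun i _ => ?_
          rcases lt_trichotomy (f n (y i)) 0 with h | h | h <;> simp [h]
      _ = K := one_mul K
  obtain ⟨k, hk⟩ := exists_nat_ge (K / (ε / 2))
  obtain ⟨σ, hσ, hoff⟩ := exists_injective_offDiag_sum_le (half_pos hε).le k
    (fun n i => |f n (y i)|) fun n s => (hrow n s).trans ((div_le_iff₀ (half_pos hε)).1 hk)
  -- Injectivity of `σ` is what transfers the upper estimate to the subfamily `y ∘ σ`.
  have hyσ : ∀ (s : Finset ℕ) (c : ℕ → ℝ) (M : ℝ), 0 ≤ M → (∀ i ∈ s, |c i| ≤ M) →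
      ‖∑ i ∈ s, c i • y (σ i)‖ ≤ M * K := by
    intro s c M hM hc
    have h := hy (s.map ⟨σ, hσ⟩) (fun j => c (Function.invFun σ j)) M hM
      (by simpa [Function.leftInverse_invFun hσ _] using hc)
    simpa [Function.leftInverse_invFun hσ _] using h
  have hsum := summable_smul_of_norm_sum_smul_le hyσ
  let L : C₀(ℕ, ℝ) →ₗ[ℝ] Y :=
    { toFun := fun x => ∑' i, x i • y (σ i)
      map_add' := fun x x' => by
        simp only [ZeroAtInftyContinuousMap.add_apply, add_smul]
        exact (hsum x).tsum_add (hsum x')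
      map_smul' := fun c x => by
        simp only [ZeroAtInftyContinuousMap.smul_apply, smul_assoc, RingHom.id_apply]
        exact (hsum x).tsum_const_smul c }
  refine ⟨L.mkContinuous K fun x => ?_, ε / 2, half_pos hε, fun x => ?_⟩
  · rw [mul_comm]
    exact le_of_tendsto (hsum x).hasSum.norm <| Filter.Eventually.of_forall fun s =>
      hyσ s x _ (norm_nonneg x) fun i _ => x.norm_apply_le i
  · change ε / 2 * ‖x‖ ≤ ‖L x‖
    have key : ∀ n, |x n| * ε ≤ ‖L x‖ + ‖x‖ * (ε / 2) := by
      intro n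
      -- Test the finite sums that contain the index `n` against the functional norming `y (σ n)`.
      refine ge_of_tendsto ((hsum x).hasSum.norm.add_const (‖x‖ * (ε / 2))) ?_
      filter_upwards [Filter.eventually_ge_atTop {n}] with s hs
      have hn : n ∈ s := hs (Finset.mem_singleton_self n)
      have hsplit : x n * ‖y (σ n)‖ =
          f (σ n) (∑ i ∈ s, x i • y (σ i)) - ∑ i ∈ s.erase n, x i * f (σ n) (y (σ i)) := by
        have hfn : f (σ n) (y (σ n)) = ‖y (σ n)‖ := hfy (σ n)
        rw [map_sum, ← Finset.add_sum_erase s _ hn, map_smul, hfn]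
        simp only [map_smul, smul_eq_mul, add_sub_cancel_right]
      have htest : |f (σ n) (∑ i ∈ s, x i • y (σ i))| ≤ ‖∑ i ∈ s, x i • y (σ i)‖ :=
        ((f (σ n)).le_of_opNorm_le (hf _) _).trans (one_mul _).le
      have hrest : |∑ i ∈ s.erase n, x i * f (σ n) (y (σ i))| ≤ ‖x‖ * (ε / 2) := calc
        _ ≤ ∑ i ∈ s.erase n, |x i * f (σ n) (y (σ i))| := Finset.abs_sum_le_sum_abs _ _
        _ ≤ ∑ i ∈ s.erase n, ‖x‖ * |f (σ n) (y (σ i))| := by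
          gcongr with i
          rw [abs_mul]
          gcongr
          exact x.norm_apply_le i
        _ = ‖x‖ * ∑ i ∈ s.erase n, |f (σ n) (y (σ i))| := by rw [Finset.mul_sum]
        _ ≤ ‖x‖ * (ε / 2) := by
          gcongr
          exact hoff n _ (s.notMem_erase n)
      calc |x n| * ε ≤ |x n| * ‖y (σ n)‖ := by
            gcongr
            exact hyε _
        _ = |x n * ‖y (σ n)‖| := by rw [abs_mul, abs_norm]
        _ ≤ _ := by
            rw [hsplit]
            exact (abs_sub _ _).trans (add_le_add htest hrest)
    have : ‖x‖ ≤ (‖L x‖ + ‖x‖ * (ε / 2)) / ε :=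
      x.norm_le_of_forall (by positivity) fun n => (le_div_iff₀ hε).2 (key n)
    rw [le_div_iff₀ hε] at this
    linarith

end BessagaPelczynski

/-! ### Increasing nets in normed lattices -/

section Lattice

variable {X : Type*} [NormedAddCommGroup X] [Lattice X] [IsOrderedAddMonoid X] [HasSolidNorm X]

theorem norm_sum_smul_le_of_nonneg [NormedSpace ℝ X] [IsOrderedModule ℝ X] {ι : Type*} {u : ι → X} (hu : ∀ i, 0 ≤ u i) {K : ℝ}
    (s : Finset ι) (hK : ‖∑ i ∈ s, u i‖ ≤ K) (c : ι → ℝ) {M : ℝ} (hM : 0 ≤ M)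
    (hc : ∀ i ∈ s, |c i| ≤ M) : ‖∑ i ∈ s, c i • u i‖ ≤ M * K := by
  have hle : |∑ i ∈ s, c i • u i| ≤ |M • ∑ i ∈ s, u i| := by
    rw [Finset.smul_sum, abs_of_nonneg (Finset.sum_nonneg fun i _ => smul_nonneg hM (hu i)),
      abs_le']
    constructor
    · exact Finset.sum_le_sum fun i hi =>
        smul_le_smul_of_nonneg_right (abs_le.1 (hc i hi)).2 (hu i)
    · rw [← Finset.sum_neg_distrib]
      refine Finset.sum_le_sum fun i hi => ?_
      rw [← neg_smul]
      exact smul_le_smul_of_nonneg_right (neg_le.1 (abs_le.1 (hc i hi)).1) (hu i)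
  calc ‖∑ i ∈ s, c i • u i‖ ≤ ‖M • ∑ i ∈ s, u i‖ := norm_le_norm_of_abs_le_abs hle
    _ = M * ‖∑ i ∈ s, u i‖ := by rw [norm_smul, Real.norm_of_nonneg hM]
    _ ≤ M * K := by gcongr

theorem norm_sum_sub_le_of_monotone {x : ℕ → X} (hx : Monotone x) {M : ℝ} (hM : ∀ n, ‖x n‖ ≤ M)
    (s : Finset ℕ) : ‖∑ i ∈ s, (x (i + 1) - x i)‖ ≤ 2 * M := by
  have hnn : ∀ i, 0 ≤ x (i + 1) - x i := fun i => sub_nonneg.2 (hx i.le_succ)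
  obtain ⟨n, hn⟩ := s.exists_nat_subset_range
  have hle : ∑ i ∈ s, (x (i + 1) - x i) ≤ x n - x 0 := by
    rw [← Finset.sum_range_sub]
    exact Finset.sum_le_sum_of_subset_of_nonneg hn fun i _ _ => hnn i
  have h0 : 0 ≤ ∑ i ∈ s, (x (i + 1) - x i) := Finset.sum_nonneg fun i _ => hnn i
  calc ‖∑ i ∈ s, (x (i + 1) - x i)‖ ≤ ‖x n - x 0‖ :=
        norm_le_norm_of_abs_le_abs (by rwa [abs_of_nonneg h0, abs_of_nonneg (h0.trans hle)])
    _ ≤ ‖x n‖ + ‖x 0‖ := norm_sub_le _ _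
    _ ≤ 2 * M := by linarith [hM n, hM 0]

end Lattice

/-- A net that is not Cauchy has an increasing sequence of indices along which consecutive terms
stay a fixed distance apart. -/
theorem exists_monotone_seq_of_not_cauchy {ι : Type*} [Preorder ι] [IsDirectedOrder ι] [Nonempty ι]
    {Y : Type*} [PseudoMetricSpace Y] {y : ι → Y} (h : ¬ Cauchy (Filter.map y Filter.atTop)) :
    ∃ ε > 0, ∃ a : ℕ → ι, Monotone a ∧ ∀ n, ε ≤ dist (y (a (n + 1))) (y (a n)) := by
  have key : ∃ ε > 0, ∀ a, ∃ b ≥ a, ε ≤ dist (y b) (y a) := by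
    by_contra! hc
    refine h (Metric.cauchy_iff.2 ⟨inferInstance, fun ε hε => ?_⟩)
    obtain ⟨a, ha⟩ := hc (ε / 2) (half_pos hε)
    refine ⟨y '' Set.Ici a, Filter.image_mem_map (Filter.Ici_mem_atTop a), ?_⟩
    rintro _ ⟨b, hb, rfl⟩ _ ⟨c, hc, rfl⟩
    linarith [dist_triangle_right (y b) (y c) (y a), ha b hb, ha c hc]
  obtain ⟨ε, hε, hnext⟩ := key
  choose g hg hgε using hnext
  let a : ℕ → ι := fun n => g^[n] (Classical.arbitrary ι)
  have ha : ∀ n, a (n + 1) = g (a n) := fun n => Function.iterate_succ_apply' g n _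
  exact ⟨ε, hε, a, monotone_nat_of_le_succ fun n => (ha n).symm ▸ hg (a n),
    fun n => by rw [ha]; exact hgε (a n)⟩

theorem isQuasiKB_of_not_cZeroEmbeds {X : Type u} {Y : Type v} [NormedAddCommGroup X]
    [NormedSpace ℝ X] [Lattice X] [IsOrderedAddMonoid X] [IsOrderedModule ℝ X] [HasSolidNorm X]
    [NormedAddCommGroup Y] [NormedSpace ℝ Y] [CompleteSpace Y] (hY : ¬ CZeroEmbeds Y)
    (T : X →L[ℝ] Y) : IsQuasiKB.{u, v, w} (T : X →ₗ[ℝ] Y) := by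
  intro ι _ _ _ x hx _ ⟨M, hM⟩
  by_contra hnc
  obtain ⟨ε, hε, a, ha, haε⟩ := exists_monotone_seq_of_not_cauchy hnc
  refine hY (cZeroEmbeds_of_norm_sum_smul_le (y := fun n => T (x (a (n + 1)) - x (a n)))
    (K := ‖T‖ * (2 * M)) (ε := ε) (fun s c C hC hc => ?_) hε fun n => ?_)
  · have hmono : Monotone fun n => x (a n) := hx.comp ha
    have h1 := norm_sum_smul_le_of_nonneg (u := fun n => x (a (n + 1)) - x (a n))
      (fun i => sub_nonneg.2 (hmono i.le_succ)) s
      (norm_sum_sub_le_of_monotone hmono (fun n => hM (a n)) s) c hC hc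
    calc ‖∑ i ∈ s, c i • T (x (a (i + 1)) - x (a i))‖
        = ‖T (∑ i ∈ s, c i • (x (a (i + 1)) - x (a i)))‖ := by simp only [map_sum, map_smul]
      _ ≤ ‖T‖ * (C * (2 * M)) := T.le_opNorm_of_le h1
      _ = C * (‖T‖ * (2 * M)) := by ring
  · simpa [dist_eq_norm] using haε n

/-! ### The Banach lattice `c₀` -/

namespace ZeroAtInftyContinuousMap

variable {ι : Type*} [TopologicalSpace ι]

instance : LE C₀(ι, ℝ) := ⟨fun f g => ∀ i, f i ≤ g i⟩

instance : LT C₀(ι, ℝ) := ⟨fun f g => (f : ι → ℝ) < g⟩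

instance : Max C₀(ι, ℝ) :=
  ⟨fun f g => ⟨⟨fun i => f i ⊔ g i, by fun_prop⟩, by
    simpa using f.zero_at_infty'.sup_nhds g.zero_at_infty'⟩⟩

instance : Min C₀(ι, ℝ) :=
  ⟨fun f g => ⟨⟨fun i => f i ⊓ g i, by fun_prop⟩, by
    simpa using f.zero_at_infty'.inf_nhds g.zero_at_infty'⟩⟩

/-- The pointwise order makes `C₀(ι, ℝ)` a vector lattice. -/
instance : Lattice C₀(ι, ℝ) :=
  DFunLike.coe_injective.lattice _ .rfl .rfl (fun _ _ => rfl) fun _ _ => rfl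

instance : IsOrderedAddMonoid C₀(ι, ℝ) where
  add_le_add_left _ _ h c i := add_le_add_left (h i) (c i)

instance : IsOrderedModule ℝ C₀(ι, ℝ) where
  smul_le_smul_of_nonneg_left _ hc _ _ h i := mul_le_mul_of_nonneg_left (h i) hc
  smul_le_smul_of_nonneg_right _ hf _ _ h i := mul_le_mul_of_nonneg_right h (hf i)

instance : HasSolidNorm C₀(ι, ℝ) where
  solid f g h := f.norm_le_of_forall (norm_nonneg g) fun i => (h i).trans (g.norm_apply_le i)

end ZeroAtInftyContinuousMap

/-- The indicator of a finite set, as an element of `c₀`. -/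
noncomputable def finsetIndicator {ι : Type*} [TopologicalSpace ι] [DiscreteTopology ι]
    (s : Finset ι) : C₀(ι, ℝ) where
  toFun := (s : Set ι).indicator 1
  continuous_toFun := continuous_of_discreteTopology
  zero_at_infty' := by
    rw [Filter.cocompact_eq_cofinite]
    refine tendsto_nhds_of_eventually_eq ?_
    filter_upwards [s.finite_toSet.compl_mem_cofinite] with i hi
    exact Set.indicator_of_notMem hi _

/-- The copy of `c₀` over `ULift ℕ`, mapped onto `c₀`. -/
noncomputable def uliftToCZero : C₀(ULift.{u} ℕ, ℝ) →L[ℝ] C₀(ℕ, ℝ) :=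
  (ZeroAtInftyContinuousMap.compLinearMap
    ⟨⟨ULift.up, continuous_of_discreteTopology⟩, by
      simpa only [Filter.cocompact_eq_cofinite] using ULift.up_injective.tendsto_cofinite⟩ :
      C₀(ULift.{u} ℕ, ℝ) →ₗ[ℝ] C₀(ℕ, ℝ)).mkContinuous 1 fun x => by
    rw [one_mul]
    exact ZeroAtInftyContinuousMap.norm_le_of_forall (norm_nonneg x) fun i => x.norm_apply_le _

theorem uliftToCZero_apply (x : C₀(ULift.{u} ℕ, ℝ)) (n : ℕ) : uliftToCZero x n = x ⟨n⟩ := rfl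

/-- An embedding of `c₀` is not quasi KB. -/
theorem exists_not_isQuasiKB_of_cZeroEmbeds {Y : Type v} [NormedAddCommGroup Y] [NormedSpace ℝ Y]
    (hY : CZeroEmbeds Y) :
    ∃ T : C₀(ULift.{u} ℕ, ℝ) →L[ℝ] Y, ¬ IsQuasiKB.{u, v, w} (T : C₀(ULift.{u} ℕ, ℝ) →ₗ[ℝ] Y) := by
  obtain ⟨J, c, hc, hJ⟩ := hY
  refine ⟨J.comp uliftToCZero, fun h => ?_⟩
  let x : ULift.{w} ℕ → C₀(ULift.{u} ℕ, ℝ) := fun n =>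
    finsetIndicator ((Finset.range n.down).map ⟨ULift.up, ULift.up_injective⟩)
  have hx : ∀ (n : ULift.{w} ℕ) (i : ℕ), x n ⟨i⟩ = if i < n.down then 1 else 0 := by
    intro n i
    change (_ : Set (ULift ℕ)).indicator 1 _ = _
    classical
    rw [Set.indicator_apply]
    simp
  have hcau := h (ULift.{w} ℕ) x
    (fun m n hmn ⟨i⟩ => by
      have : m.down ≤ n.down := hmn
      rw [hx, hx]
      split_ifs <;> first | omega | norm_num)
    (fun n ⟨i⟩ => by
      rw [hx]
      change (0 : ℝ) ≤ _
      split_ifs <;> norm_num)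
    ⟨1, fun n => ZeroAtInftyContinuousMap.norm_le_of_forall zero_le_one fun ⟨i⟩ => by
      rw [hx]
      split_ifs <;> norm_num⟩
  obtain ⟨-, hcau⟩ := Metric.cauchy_iff.1 hcau
  obtain ⟨t, ht, hdist⟩ := hcau c hc
  obtain ⟨⟨N⟩, hN⟩ := Filter.mem_atTop_sets.1 (Filter.mem_map.1 ht)
  have h1 := hdist _ (hN ⟨N + 1⟩ N.le_succ) _ (hN ⟨N⟩ le_rfl)
  have h2 := hJ (uliftToCZero (x ⟨N + 1⟩ - x ⟨N⟩))
  have h3 : (1 : ℝ) ≤ ‖uliftToCZero (x ⟨N + 1⟩ - x ⟨N⟩)‖ := by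
    refine le_trans ?_ (ZeroAtInftyContinuousMap.norm_apply_le _ N)
    rw [uliftToCZero_apply, ZeroAtInftyContinuousMap.sub_apply, hx, hx]
    simp
  have h4 : ‖J (uliftToCZero (x ⟨N + 1⟩ - x ⟨N⟩))‖ < c := by
    simpa [dist_eq_norm] using h1
  nlinarith

theorem mainTheorem1 (Y : Type v) [NormedAddCommGroup Y] [NormedSpace ℝ Y] [CompleteSpace Y] :
    (∀ (X : Type u) [NormedAddCommGroup X] [NormedSpace ℝ X] [CompleteSpace X] [Lattice X]
        [IsOrderedAddMonoid X] [IsOrderedModule ℝ X] [HasSolidNorm X] (T : X →L[ℝ] Y),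
        IsQuasiKB.{u, v, w} (T : X →ₗ[ℝ] Y)) ↔
      ¬ CZeroEmbeds Y := by
  constructor
  · intro h hY
    obtain ⟨T, hT⟩ := exists_not_isQuasiKB_of_cZeroEmbeds.{u, v, w} hY
    exact hT (h _ T)
  · intro hY X _ _ _ _ _ _ _ T
    exact isQuasiKB_of_not_cZeroEmbeds hY T
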